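/- Let $N\in\mathbb N$, natural frequencies $\Omega=(\Omega_1,\dots,\Omega_N)\in\mathbb R^N$, initial phases $\Theta_0\in\mathbb R^N$, a coupling strength $K>0$, a constant $c>0$ and $\alpha\in(\tfrac12,1)$ be given. For $\theta\in\mathbb R$ let $|\theta|_o$ be the absolute value of the representative of $\theta$ modulo $2\pi$ in $(-\pi,\pi]$, and define the regularized and singular kernels $$h_\varepsilon(\theta)=\frac{\sin\theta}{(\varepsilon^2+c|\theta|_o^2)^\alpha}\quad(\varepsilon>0),\qquad h(\theta)=\frac{\sin\theta}{c^\alpha|\theta|_o^{2\alpha}}\ \text{ for }\theta\notin 2\pi\mathbb Z,\quad h=0\ \text{ on } 2\pi\mathbb Z,$$ the vector fields $H^\varepsilon,H:\mathbb R^N\to\mathbb R^N$, $$H^\varepsilon_i(\Theta)=\Omega_i+\frac KN\sum_{j=1}^N h_\varepsilon(\theta_j-\theta_i),\qquad H_i(\Theta)=\Omega_i+\frac KN\sum_{j=1}^N h(\theta_j-\theta_i),$$ and the interaction potentials $$V^\varepsilon_{int}(\Theta)=\frac K{2N}\sum_{i\ne j}\int_0^{\theta_i-\theta_j}h_\varepsilon(s)\,ds,\qquad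 V_{int}(\Theta)=\frac K{2N}\sum_{i\ne j}\int_0^{\theta_i-\theta_j}h(s)\,ds .$$ Let $\mathcal H$ be the Filippov set-valued map of $H$, $$\mathcal H(\Theta)=\bigcap_{\delta>0}\ \bigcap_{|\mathcal N|=0}\overline{\mathrm{co}}\,\bigl(H(B_\delta(\Theta)\setminus\mathcal N)\bigr).$$ For every $\varepsilon>0$ let $\Theta^\varepsilon:[0,\infty)\to\mathbb R^N$ be the classical solution of $\dot\Theta^\varepsilon=H^\varepsilon(\Theta^\varepsilon)$, $\Theta^\varepsilon(0)=\Theta_0$. Then: 1. This system is the gradient flow $\dot\Theta^\varepsilon=-\nabla V^\varepsilon(\Theta^\varepsilon)$ of $V^\varepsilon(\Theta)=-\sum_i\Omega_i\theta_i+V^\varepsilon_{int}(\Theta)$, that is, $-\nabla V^\varepsilon=H^\varepsilon$ for every $\varepsilon>0$. 2. (Energy estimate.) For all $\varepsilon>0$ and $t>0$, $$\frac12\int_0^t|\dot\Theta^\varepsilon(s)|^2\,ds\le\frac{|\Omega|^2}{2}\,t+V_{int}(\Theta_0).$$ 3. (Boundedness in $H^1_{loc}$.) For every $T>0$ there is a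 constant $C$ such that $\Theta^\varepsilon\in H^1((0,T),\mathbb R^N)$ and $\|\Theta^\varepsilon\|_{H^1((0,T),\mathbb R^N)}\le C$ for all $\varepsilon>0$. 4. (Singular limit.) Let $\varepsilon_n>0$, $\varepsilon_n\to0$, and let $\Theta\in H^1_{loc}$ be such that $\Theta^{\varepsilon_n}\rightharpoonup\Theta$ weakly in $H^1((0,T),\mathbb R^N)$ for every $T>0$. Then $$\dot\Theta(t)\in\mathcal H(\Theta(t))\quad\text{for a.e. }t\ge0,$$ where $\dot\Theta$ is the weak derivative. Consequently $\Theta$ is a Filippov solution of the singular system: it coincides almost everywhere on $(0,\infty)$ with a function $\Phi:[0,\infty)\to\mathbb R^N$ that is absolutely continuous on every $[0,T]$, satisfies $\Phi(0)=\Theta_0$, and is differentiable with $\dot\Phi(t)\in\mathcal H(\Phi(t))$ for a.e. $t\ge0$. -/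

import Mathlib

open Set Filter Topology MeasureTheory
open scoped ContDiff ENNReal

namespace SingularKuramoto

/-- The phase space `ℝ^N` with its Euclidean norm. -/
abbrev Phase (N : ℕ) : Type := EuclideanSpace ℝ (Fin N)

/-! ### Kernels, vector fields and potentials -/

/-- The orthodromic distance `|θ|_o` to zero: the absolute value of the representative of `θ`
modulo `2π` in `(-π, π]`. -/
noncomputable def orthoDist (θ : ℝ) : ℝ := |(θ : Real.Angle).toReal|

/-- The regularized kernel `h_ε(θ) = sin θ / (ε² + c |θ|_o²)^α`. -/
noncomputable def regKernel (α c ε : ℝ) (θ : ℝ) : ℝ :=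
  Real.sin θ / (ε ^ 2 + c * orthoDist θ ^ 2) ^ α

/-- The singular kernel `h(θ) = sin θ / (c^α |θ|_o^(2α))` (with value `0` on `2πℤ`). -/
noncomputable def singKernel (α c : ℝ) (θ : ℝ) : ℝ :=
  Real.sin θ / (c ^ α * orthoDist θ ^ (2 * α))

/-- The Kuramoto vector field with kernel `k`: the `i`-th component is
`Ω_i + (K/N) ∑_j k(θ_j - θ_i)`. -/
noncomputable def vectorField {N : ℕ} (Ω : Phase N) (K : ℝ) (k : ℝ → ℝ) (x : Phase N) : Phase N :=
  WithLp.toLp 2 fun i => Ω i + K / N * ∑ j, k (x j - x i)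

/-- The interaction potential `V_int(Θ) = (K/2N) ∑_{i ≠ j} W(θ_i - θ_j)`, where
`W(θ) = ∫_0^θ k` is the primitive of the kernel `k`. -/
noncomputable def interactionPotential {N : ℕ} (K : ℝ) (k : ℝ → ℝ) (x : Phase N) : ℝ :=
  K / (2 * N) * ∑ i, ∑ j ∈ Finset.univ.filter (fun j => j ≠ i), ∫ s in (0 : ℝ)..(x i - x j), k s

/-- The full potential `V(Θ) = -∑_i Ω_i θ_i + V_int(Θ)`. -/
noncomputable def potential {N : ℕ} (Ω : Phase N) (K : ℝ) (k : ℝ → ℝ) (x : Phase N) : ℝ :=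
  -(∑ i, Ω i * x i) + interactionPotential K k x

/-- `u` is a classical solution on `[0,∞)` of `u' = F(u)`, `u(0) = x₀`
(the derivative at `t = 0` is one-sided). -/
def IsClassicalSolution {N : ℕ} (F : Phase N → Phase N) (x₀ : Phase N) (u : ℝ → Phase N) : Prop :=
  u 0 = x₀ ∧ ∀ t : ℝ, 0 ≤ t → HasDerivWithinAt u (F (u t)) (Ici 0) t

/-! ### Filippov solutions -/

/-- The Filippov set-valued map of `F`: the intersection, over all `δ > 0` and all Lebesgue-null
sets `S`, of the closed convex hulls of `F (B_δ(x) \ S)`. -/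
def filippovMap {N : ℕ} (F : Phase N → Phase N) (x : Phase N) : Set (Phase N) :=
  {v | ∀ δ : ℝ, 0 < δ → ∀ S : Set (Phase N), volume S = 0 →
    v ∈ closure (convexHull ℝ (F '' (Metric.ball x δ \ S)))}

/-- A (global, forward) solution in Filippov's sense of `u' = F(u)`, `u(0) = x₀`: locally
absolutely continuous on `[0,∞)` and solving the differential inclusion almost everywhere. -/
def IsFilippovSolution {N : ℕ} (F : Phase N → Phase N) (x₀ : Phase N) (u : ℝ → Phase N) : Prop :=
  u 0 = x₀ ∧ (∀ T : ℝ, 0 < T → AbsolutelyContinuousOnInterval u 0 T) ∧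
    ∀ᵐ t ∂(volume.restrict (Ioi (0 : ℝ))), ∃ v ∈ filippovMap F (u t), HasDerivAt u v t

/-! ### The Sobolev space `H¹((0,T), ℝ^N)` and weak `H¹_loc` limits -/

/-- `L²((0,T), ℝ^N)`. -/
abbrev L2 (N : ℕ) (T : ℝ) : Type := Lp (Phase N) 2 (volume.restrict (Ioo (0 : ℝ) T))

/-- Test functions on `(0,T)`: smooth with compact support in the open interval. -/
def IsTestFunction (T : ℝ) (φ : ℝ → ℝ) : Prop :=
  ContDiff ℝ ∞ φ ∧ HasCompactSupport φ ∧ tsupport φ ⊆ Ioo 0 T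

theorem integrable_smul_L2 {N : ℕ} {T : ℝ} {φ : ℝ → ℝ} (hφ : Continuous φ)
    (hc : HasCompactSupport φ) (f : L2 N T) :
    Integrable (fun t => φ t • f t) (volume.restrict (Ioo (0 : ℝ) T)) := by
  obtain ⟨C, hC⟩ := hφ.bounded_above_of_compact_support hc
  have hf : Integrable f (volume.restrict (Ioo (0 : ℝ) T)) :=
    (Lp.memLp f).integrable (by norm_num)
  exact hf.bdd_smul C hφ.aestronglyMeasurable (Eventually.of_forall hC)

/-- `H¹((0,T), ℝ^N)`, as the space of pairs `(u, u')` in `L² × L²` where `u'` is the weak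
derivative of `u`; the norm inherited from the Hilbert sum is
`‖u‖²_{H¹} = ‖u‖²_{L²} + ‖u'‖²_{L²}`. -/
noncomputable def H1 (N : ℕ) (T : ℝ) : Submodule ℝ (WithLp 2 (L2 N T × L2 N T)) where
  carrier := {p | ∀ φ : ℝ → ℝ, IsTestFunction T φ →
    ∫ t in Ioo 0 T, deriv φ t • p.fst t = -∫ t in Ioo 0 T, φ t • p.snd t}
  zero_mem' := by
    intro φ _
    have h : ∀ ψ : ℝ → ℝ, ∫ t in Ioo 0 T, ψ t • (0 : L2 N T) t = 0 := by
      intro ψ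
      refine integral_eq_zero_of_ae ?_
      filter_upwards [Lp.coeFn_zero (Phase N) 2 (volume.restrict (Ioo (0 : ℝ) T))] with t ht
      have ht' : (0 : L2 N T) t = 0 := ht
      rw [ht', smul_zero, Pi.zero_apply]
    simp only [WithLp.zero_fst, WithLp.zero_snd, h, neg_zero]
  add_mem' := by
    intro p q hp hq φ hφ
    have h : ∀ ψ : ℝ → ℝ, Continuous ψ → HasCompactSupport ψ → ∀ f g : L2 N T,
        ∫ t in Ioo 0 T, ψ t • (f + g) t
          = (∫ t in Ioo 0 T, ψ t • f t) + ∫ t in Ioo 0 T, ψ t • g t := by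
      intro ψ h1 h2 f g
      rw [← integral_add (integrable_smul_L2 h1 h2 f) (integrable_smul_L2 h1 h2 g)]
      refine integral_congr_ae ?_
      filter_upwards [Lp.coeFn_add f g] with t ht
      rw [ht, Pi.add_apply, smul_add]
    simp only [WithLp.add_fst, WithLp.add_snd]
    rw [h _ (hφ.1.continuous_deriv (by simp)) hφ.2.1.deriv, h _ hφ.1.continuous hφ.2.1,
      hp φ hφ, hq φ hφ, neg_add]
  smul_mem' := by
    intro a p hp φ hφ
    have h : ∀ ψ : ℝ → ℝ, ∀ f : L2 N T,
        ∫ t in Ioo 0 T, ψ t • (a • f) t = a • ∫ t in Ioo 0 T, ψ t • f t := by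
      intro ψ f
      rw [← integral_smul]
      refine integral_congr_ae ?_
      filter_upwards [Lp.coeFn_smul a f] with t ht
      rw [ht, Pi.smul_apply, smul_comm]
    simp only [WithLp.smul_fst, WithLp.smul_snd]
    rw [h, h, hp φ hφ, smul_neg]

/-- The function `u` belongs to `H¹((0,T), ℝ^N)` and `p` is the corresponding element. -/
def RepresentsH1 {N : ℕ} {T : ℝ} (p : H1 N T) (u : ℝ → Phase N) : Prop :=
  u =ᵐ[volume.restrict (Ioo (0 : ℝ) T)] p.1.fst

/-- The sequence `u n` converges to `v` weakly in `H¹((0,T), ℝ^N)` for every `T > 0`, and `v'` is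
the weak derivative of `v` on `(0,∞)`. Weak convergence in `H¹((0,T), ℝ^N)` is convergence against
all continuous linear functionals. -/
def IsWeakH1LocLimit {N : ℕ} (u : ℕ → ℝ → Phase N) (v v' : ℝ → Phase N) : Prop :=
  ∀ T : ℝ, 0 < T → ∃ (p : ℕ → H1 N T) (q : H1 N T),
    (∀ n, RepresentsH1 (p n) (u n)) ∧ RepresentsH1 q v ∧
    v' =ᵐ[volume.restrict (Ioo (0 : ℝ) T)] q.1.snd ∧
    ∀ ℓ : H1 N T →L[ℝ] ℝ, Tendsto (fun n => ℓ (p n)) atTop (𝓝 (ℓ q))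

end SingularKuramoto

namespace SingularKuramoto

/-! ### Elementary properties of the kernels -/

/-! Oddness of the kernel gives both the gradient structure and the symmetrized pairing
`inner_vectorField`, where each pair `i, j` enters through `(w i - w j) * k (y j - y i)`.

Energy: the primitive of the regularized kernel is nonnegative and lies below that of the singular
kernel, which is integrable because `α < 1`. The energy identity, with the drift absorbed by Young's
inequality, therefore bounds the dissipation uniformly in `ε`, and with it the `H¹` norm.

Limit: phases with `cos (x j - x i) = 1` have collided and form clusters. If `w` is constant on
clusters, pairing with `w` removes every singular term and leaves an expression jointly continuous
in `ε` and the state, even at `ε = 0`. So the derivative of the limit has the same pairing with `w`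
as the singular field (`inner_deriv_eq_of_tendsto`). These pairings suffice for membership in the
Filippov set (`mem_filippovMap_of_inner_eq`): a separating functional `w` that is not constant on
clusters cannot exist, since for `α > 1/2` the field paired with `w` tends to `+∞` along `x - r • w`
as `r → 0+`; if `w` is constant on clusters, continuity at `x` gives the contradiction. -/

theorem orthoDist_eq_arccos_cos (θ : ℝ) : orthoDist θ = Real.arccos (Real.cos θ) := by
  have h : Real.cos θ = Real.cos |(θ : Real.Angle).toReal| := by
    rw [Real.cos_abs, Real.Angle.cos_toReal, Real.Angle.cos_coe]
  rw [h, Real.arccos_cos (abs_nonneg _) (Real.Angle.abs_toReal_le_pi _), orthoDist]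

theorem orthoDist_nonneg (θ : ℝ) : 0 ≤ orthoDist θ := abs_nonneg _

theorem continuous_orthoDist : Continuous orthoDist := by
  rw [funext orthoDist_eq_arccos_cos]
  exact Real.continuous_arccos.comp Real.continuous_cos

theorem orthoDist_neg (θ : ℝ) : orthoDist (-θ) = orthoDist θ := by
  simp [orthoDist_eq_arccos_cos]

theorem orthoDist_periodic : Function.Periodic orthoDist (2 * Real.pi) := fun θ => by
  simp [orthoDist_eq_arccos_cos]

theorem orthoDist_of_mem_Icc {θ : ℝ} (h : θ ∈ Icc 0 Real.pi) : orthoDist θ = θ := by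
  rw [orthoDist_eq_arccos_cos, Real.arccos_cos h.1 h.2]

theorem orthoDist_pos {θ : ℝ} (h : Real.cos θ ≠ 1) : 0 < orthoDist θ := by
  rw [orthoDist_eq_arccos_cos, Real.arccos_pos]
  exact lt_of_le_of_ne (Real.cos_le_one θ) h

/-- Treats the singular kernel as the endpoint `ε = 0` of the family, so that symmetry, periodicity
and joint continuity are proved once. -/
theorem singKernel_eq_regKernel_zero (α : ℝ) {c : ℝ} (hc : 0 ≤ c) :
    singKernel α c = regKernel α c 0 := by
  funext θ
  have h : orthoDist θ ^ (2 * α) = (orthoDist θ ^ 2) ^ α := by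
    rw [Real.rpow_mul (orthoDist_nonneg θ), Real.rpow_two]
  rw [singKernel, regKernel, h, ← Real.mul_rpow hc (sq_nonneg _)]
  simp

theorem regKernel_neg (α c ε θ : ℝ) : regKernel α c ε (-θ) = -regKernel α c ε θ := by
  simp [regKernel, orthoDist_neg, neg_div]

theorem regKernel_periodic (α c ε : ℝ) :
    Function.Periodic (regKernel α c ε) (2 * Real.pi) := fun θ => by
  simp only [regKernel, orthoDist_periodic θ, Real.sin_periodic θ]

theorem regKernel_nonneg {α c ε θ : ℝ} (hc : 0 ≤ c) (h : θ ∈ Icc 0 Real.pi) :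
    0 ≤ regKernel α c ε θ :=
  div_nonneg (Real.sin_nonneg_of_nonneg_of_le_pi h.1 h.2) (Real.rpow_nonneg (by positivity) _)

theorem regKernel_le_singKernel {α c ε θ : ℝ} (hc : 0 < c) (hα : 0 ≤ α)
    (h : θ ∈ Icc 0 Real.pi) : regKernel α c ε θ ≤ singKernel α c θ := by
  rw [singKernel_eq_regKernel_zero α hc.le]
  rcases h.1.eq_or_lt with rfl | h0
  · simp [regKernel]
  have hd : 0 < orthoDist θ := by rwa [orthoDist_of_mem_Icc h]
  refine div_le_div_of_nonneg_left (Real.sin_nonneg_of_nonneg_of_le_pi h.1 h.2)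
    (Real.rpow_pos_of_pos (by positivity) _)
    (Real.rpow_le_rpow (by positivity) ?_ hα)
  nlinarith [sq_nonneg ε]

/-- Joint continuity of the kernel in the regularization parameter and the angle. -/
theorem continuousAt_regKernel (α : ℝ) {c ε θ : ℝ} (hc : 0 < c)
    (h : ε ≠ 0 ∨ Real.cos θ ≠ 1) :
    ContinuousAt (fun p : ℝ × ℝ => regKernel α c p.1 p.2) (ε, θ) := by
  have hpos : 0 < ε ^ 2 + c * orthoDist θ ^ 2 := by
    rcases h with h | h
    · positivity
    · have := orthoDist_pos h
      positivity
  have hd : ContinuousAt (fun p : ℝ × ℝ => p.1 ^ 2 + c * orthoDist p.2 ^ 2) (ε, θ) := by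
    have := continuous_orthoDist
    fun_prop
  unfold regKernel
  refine ContinuousAt.div (by fun_prop) (hd.rpow_const (Or.inl hpos.ne'))
    (Real.rpow_pos_of_pos hpos _).ne'

theorem continuous_regKernel (α : ℝ) {c ε : ℝ} (hc : 0 < c) (hε : ε ≠ 0) :
    Continuous (regKernel α c ε) :=
  continuous_iff_continuousAt.2 fun θ =>
    (continuousAt_regKernel α hc (Or.inl hε) : ContinuousAt _ (ε, θ)).comp
      (f := fun t : ℝ => (ε, t)) (by fun_prop)

/-- On `(0, π]` the bound `sin s ≤ s` gives a multiple of `s ^ (1 - 2α)`, whose exponent exceeds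
`-1`; oddness and periodicity do the rest. -/
theorem intervalIntegrable_singKernel {α c : ℝ} (hc : 0 < c) (hα : α < 1) (a b : ℝ) :
    IntervalIntegrable (singKernel α c) volume a b := by
  have hmeas : Measurable (singKernel α c) := by
    have := continuous_orthoDist.measurable
    unfold singKernel
    fun_prop
  have h1 : IntervalIntegrable (singKernel α c) volume 0 Real.pi := by
    have hg : IntervalIntegrable (fun s : ℝ => (c ^ α)⁻¹ * s ^ (1 - 2 * α)) volume 0 Real.pi :=
      (intervalIntegral.intervalIntegrable_rpow' (by linarith)).const_mul _
    refine hg.mono_fun hmeas.aestronglyMeasurable ?_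
    rw [uIoc_of_le Real.pi_pos.le]
    filter_upwards [ae_restrict_mem measurableSet_Ioc] with s hs
    have hs' : s ∈ Icc 0 Real.pi := ⟨hs.1.le, hs.2⟩
    have h0 : 0 < c ^ α := Real.rpow_pos_of_pos hc _
    have h2 : 0 ≤ s ^ (1 - 2 * α) := Real.rpow_nonneg hs.1.le _
    have h3 : 0 ≤ singKernel α c s := by
      rw [singKernel_eq_regKernel_zero α hc.le]; exact regKernel_nonneg hc.le hs'
    rw [Real.norm_of_nonneg h3, Real.norm_of_nonneg (by positivity), singKernel,
      orthoDist_of_mem_Icc hs', Real.rpow_sub hs.1, Real.rpow_one, mul_comm (c ^ α), ← div_div,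
      div_eq_inv_mul]
    have h5 : 0 ≤ s ^ (2 * α) := Real.rpow_nonneg hs.1.le _
    gcongr
    exact Real.sin_le hs.1.le
  have hodd : ∀ x, -singKernel α c x = singKernel α c (-x) := fun x => by
    rw [singKernel_eq_regKernel_zero α hc.le, regKernel_neg]
  have h2 : IntervalIntegrable (singKernel α c) volume (-Real.pi) 0 := by
    rw [IntervalIntegrable.iff_comp_neg]
    simp_rw [← hodd]
    rw [neg_neg, neg_zero]
    exact h1.symm.neg
  refine Function.Periodic.intervalIntegrable (T := 2 * Real.pi) (t := -Real.pi) ?_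
    Real.two_pi_pos.ne' ?_ a b
  · rw [singKernel_eq_regKernel_zero α hc.le]; exact regKernel_periodic α c 0
  · convert h2.trans h1 using 1; ring

/-- The primitive of an odd `2π`-periodic function that is nonnegative on `[0, π]` is
nonnegative. -/
theorem integral_nonneg_of_odd_periodic {f : ℝ → ℝ}
    (hint : ∀ a b, IntervalIntegrable f volume a b) (hodd : ∀ x, f (-x) = -f x)
    (hper : Function.Periodic f (2 * Real.pi)) (hpos : ∀ x ∈ Icc 0 Real.pi, 0 ≤ f x) (θ : ℝ) :
    0 ≤ ∫ s in (0 : ℝ)..θ, f s := by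
  have hneg : ∀ a b : ℝ, ∫ s in (-a)..(-b), f s = ∫ s in a..b, f s := fun a b => by
    have h := intervalIntegral.integral_comp_neg (a := b) (b := a) f
    rw [← h, intervalIntegral.integral_symm a b]
    simp_rw [hodd, intervalIntegral.integral_neg, neg_neg]
  have hpi : ∀ x ∈ Icc 0 Real.pi, 0 ≤ ∫ s in (0 : ℝ)..x, f s := fun x hx =>
    intervalIntegral.integral_nonneg hx.1 fun s hs => hpos s ⟨hs.1, hs.2.trans hx.2⟩
  -- Over `[-π, π]` the two halves cancel by oddness. The primitive is thus even and periodic, which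
  -- reduces `θ` to `[0, π]`.
  have hzero : ∫ s in (0 : ℝ)..(2 * Real.pi), f s = 0 := by
    have h := hper.intervalIntegral_add_eq 0 (-Real.pi)
    rw [zero_add] at h
    rw [h, show -Real.pi + 2 * Real.pi = Real.pi by ring,
      ← intervalIntegral.integral_add_adjacent_intervals (hint _ 0) (hint _ _)]
    have := hneg Real.pi 0
    rw [neg_zero] at this
    rw [this, intervalIntegral.integral_symm, neg_add_cancel]
  obtain ⟨x, hx, n, hn⟩ : ∃ x ∈ Ioc (-Real.pi) Real.pi, ∃ n : ℤ, θ = x + n • (2 * Real.pi) := by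
    refine ⟨toIocMod Real.two_pi_pos (-Real.pi) θ, ?_, toIocDiv Real.two_pi_pos (-Real.pi) θ, ?_⟩
    · have := toIocMod_mem_Ioc Real.two_pi_pos (-Real.pi) θ
      rwa [show -Real.pi + 2 * Real.pi = Real.pi by ring] at this
    · exact (toIocMod_add_toIocDiv_zsmul Real.two_pi_pos (-Real.pi) θ).symm
  have hred : ∫ s in (0 : ℝ)..θ, f s = ∫ s in (0 : ℝ)..x, f s := by
    rw [hn, ← intervalIntegral.integral_add_adjacent_intervals (hint 0 x) (hint _ _),
      hper.intervalIntegral_add_zsmul_eq n x hint, hper.intervalIntegral_add_eq x 0, zero_add,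
      hzero, smul_zero, add_zero]
  rw [hred]
  rcases le_total 0 x with h | h
  · exact hpi x ⟨h, hx.2⟩
  · have := hneg 0 x
    rw [neg_zero] at this
    rw [← this]
    exact hpi (-x) ⟨by linarith, by linarith [hx.1]⟩

theorem integral_regKernel_nonneg {α c ε : ℝ} (hc : 0 < c) (hε : ε ≠ 0) (θ : ℝ) :
    0 ≤ ∫ s in (0 : ℝ)..θ, regKernel α c ε s :=
  integral_nonneg_of_odd_periodic
    (fun a b => (continuous_regKernel α hc hε).intervalIntegrable a b)
    (regKernel_neg α c ε) (regKernel_periodic α c ε) (fun _ h => regKernel_nonneg hc.le h) θ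

/-- The kernels are ordered pointwise only where the sine is nonnegative, but their difference is
again odd, periodic and nonnegative on `[0, π]`. -/
theorem integral_regKernel_le {α c ε : ℝ} (hc : 0 < c) (hα0 : 0 ≤ α) (hα : α < 1) (hε : ε ≠ 0)
    (θ : ℝ) : ∫ s in (0 : ℝ)..θ, regKernel α c ε s ≤ ∫ s in (0 : ℝ)..θ, singKernel α c s := by
  have hr := fun a b => (continuous_regKernel α hc hε).intervalIntegrable (μ := volume) a b
  have hs := fun a b => intervalIntegrable_singKernel hc hα a b
  rw [← sub_nonneg, ← intervalIntegral.integral_sub (hs _ _) (hr _ _)]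
  refine integral_nonneg_of_odd_periodic (f := fun s => singKernel α c s - regKernel α c ε s)
    (fun a b => (hs a b).sub (hr a b)) (fun x => ?_) (fun x => ?_)
    (fun x hx => sub_nonneg.2 (regKernel_le_singKernel hc hα0 hx)) θ
  · simp only [singKernel_eq_regKernel_zero α hc.le, regKernel_neg]; ring
  · simp only [singKernel_eq_regKernel_zero α hc.le, regKernel_periodic α c _ x]

/-! ### Gradient structure and energy estimate -/

variable {N : ℕ}

/-- Symmetrized form of the pairing of the vector field with a fixed vector. -/
theorem inner_vectorField {k : ℝ → ℝ} (hk : ∀ x, k (-x) = -k x) (Ω : Phase N) (K : ℝ)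
    (w y : Phase N) :
    inner ℝ w (vectorField Ω K k y) =
      inner ℝ w Ω + K / (2 * N) * ∑ i, ∑ j, (w i - w j) * k (y j - y i) := by
  have h1 : ∑ i, ∑ j, (w i - w j) * k (y j - y i) = 2 * ∑ i, w i * ∑ j, k (y j - y i) := by
    -- Exchange `i` and `j`, then use oddness.
    have h2 : ∑ i, ∑ j, w j * k (y j - y i) = -∑ i, ∑ j, w i * k (y j - y i) := by
      rw [Finset.sum_comm, ← Finset.sum_neg_distrib]
      refine Finset.sum_congr rfl fun i _ => ?_
      rw [← Finset.sum_neg_distrib]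
      refine Finset.sum_congr rfl fun j _ => ?_
      rw [← neg_sub (y j) (y i), hk, mul_neg]
    simp_rw [sub_mul, Finset.sum_sub_distrib, h2, Finset.mul_sum, sub_neg_eq_add, ← two_mul,
      Finset.mul_sum]
  rw [h1]
  simp only [PiLp.inner_apply, vectorField, RCLike.inner_apply, conj_trivial]
  rw [show ∀ S : ℝ, K / (2 * N) * (2 * S) = K / N * S from fun S => by
    rw [mul_comm 2 (N : ℝ), ← div_div]; ring, Finset.mul_sum, ← Finset.sum_add_distrib]
  refine Finset.sum_congr rfl fun i _ => ?_
  ring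

theorem interactionPotential_eq_sum (K : ℝ) (k : ℝ → ℝ) (x : Phase N) :
    interactionPotential K k x =
      K / (2 * N) * ∑ i, ∑ j, ∫ s in (0 : ℝ)..(x i - x j), k s := by
  unfold interactionPotential
  congr 1
  refine Finset.sum_congr rfl fun i _ => ?_
  refine Finset.sum_filter_of_ne fun j _ hj => ?_
  rintro rfl
  simp at hj

theorem interactionPotential_mono {K : ℝ} (hK : 0 ≤ K) {k₁ k₂ : ℝ → ℝ}
    (h : ∀ θ, ∫ s in (0 : ℝ)..θ, k₁ s ≤ ∫ s in (0 : ℝ)..θ, k₂ s) (x : Phase N) :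
    interactionPotential K k₁ x ≤ interactionPotential K k₂ x := by
  rw [interactionPotential_eq_sum, interactionPotential_eq_sum]
  gcongr
  exact h _

theorem interactionPotential_nonneg {K : ℝ} (hK : 0 ≤ K) {k : ℝ → ℝ}
    (h : ∀ θ, 0 ≤ ∫ s in (0 : ℝ)..θ, k s) (x : Phase N) :
    0 ≤ interactionPotential K k x := by
  rw [interactionPotential_eq_sum]
  exact mul_nonneg (by positivity)
    (Finset.sum_nonneg fun i _ => Finset.sum_nonneg fun j _ => h _)

/-- The Kuramoto vector field with a continuous odd kernel is minus the gradient of the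
potential. -/
theorem hasGradientAt_potential {k : ℝ → ℝ} (hk : ∀ x, k (-x) = -k x) (hcont : Continuous k)
    (Ω : Phase N) (K : ℝ) (x : Phase N) :
    HasGradientAt (potential Ω K k) (-vectorField Ω K k x) x := by
  rw [hasGradientAt_iff_hasFDerivAt]
  have hproj : ∀ i : Fin N, HasFDerivAt (fun y : Phase N => y i)
      (EuclideanSpace.proj i : Phase N →L[ℝ] ℝ) x := fun i =>
    (EuclideanSpace.proj i : Phase N →L[ℝ] ℝ).hasFDerivAt
  have hW : ∀ i j : Fin N, HasFDerivAt
      (fun y : Phase N => ∫ s in (0 : ℝ)..(y i - y j), k s)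
      (k (x i - x j) • ((EuclideanSpace.proj i : Phase N →L[ℝ] ℝ) - EuclideanSpace.proj j)) x :=
    fun i j => by
      have h : HasDerivAt (fun θ => ∫ s in (0 : ℝ)..θ, k s) (k (x i - x j)) (x i - x j) :=
        (hcont.integral_hasStrictDerivAt 0 (x i - x j)).hasDerivAt
      exact h.comp_hasFDerivAt x ((hproj i).fun_sub (hproj j))
  have hV : HasFDerivAt (fun y : Phase N => -(∑ i, Ω i * y i) +
      K / (2 * N) * ∑ i, ∑ j, ∫ s in (0 : ℝ)..(y i - y j), k s)
      (-(∑ i, Ω i • (EuclideanSpace.proj i : Phase N →L[ℝ] ℝ)) + (K / (2 * N)) •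
        ∑ i, ∑ j, k (x i - x j) •
          ((EuclideanSpace.proj i : Phase N →L[ℝ] ℝ) - EuclideanSpace.proj j)) x :=
    ((HasFDerivAt.fun_sum fun i _ => (hproj i).const_mul (Ω i)).neg).add
      ((HasFDerivAt.fun_sum fun i _ => HasFDerivAt.fun_sum fun j _ => hW i j).const_mul _)
  have hfun : potential Ω K k = fun y : Phase N => -(∑ i, Ω i * y i) +
      K / (2 * N) * ∑ i, ∑ j, ∫ s in (0 : ℝ)..(y i - y j), k s := by
    funext y
    rw [potential, interactionPotential_eq_sum]
  rw [hfun]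
  refine hV.congr_fderiv ?_
  ext v
  have hsum : ∀ i j : Fin N, (v i - v j) * k (x j - x i) = -(k (x i - x j) * (v i - v j)) :=
    fun i j => by rw [← neg_sub (x i) (x j), hk]; ring
  rw [InnerProductSpace.toDual_apply_apply, inner_neg_left, real_inner_comm, inner_vectorField hk]
  simp_rw [hsum, Finset.sum_neg_distrib]
  have hpr : ∀ i, (EuclideanSpace.proj i : Phase N →L[ℝ] ℝ) v = v i := fun _ => rfl
  simp only [PiLp.inner_apply, RCLike.inner_apply, conj_trivial, add_apply, neg_apply, sum_apply,
    smul_apply, sub_apply, hpr, smul_eq_mul]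
  ring

theorem continuous_vectorField {k : ℝ → ℝ} (hcont : Continuous k) (Ω : Phase N) (K : ℝ) :
    Continuous (vectorField Ω K k) := by
  unfold vectorField
  fun_prop

namespace IsClassicalSolution

variable {F : Phase N → Phase N} {x₀ : Phase N} {u : ℝ → Phase N}

theorem continuousOn (hu : IsClassicalSolution F x₀ u) : ContinuousOn u (Ici 0) :=
  fun t ht => (hu.2 t ht).continuousWithinAt

theorem hasDerivAt (hu : IsClassicalSolution F x₀ u) {t : ℝ} (ht : 0 < t) :
    HasDerivAt u (F (u t)) t :=
  (hu.2 t ht.le).hasDerivAt (Ici_mem_nhds ht)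

theorem continuousOn_field (hF : Continuous F) (hu : IsClassicalSolution F x₀ u) :
    ContinuousOn (fun t => F (u t)) (Ici 0) :=
  hF.comp_continuousOn hu.continuousOn

theorem continuousOn_uIcc {E : Type*} [TopologicalSpace E] {f : ℝ → E}
    (hf : ContinuousOn f (Ici 0)) {s t : ℝ} (hs : 0 ≤ s) (ht : 0 ≤ t) :
    ContinuousOn f (uIcc s t) :=
  hf.mono fun _ hr => (le_min hs ht).trans hr.1

theorem integral_field (hF : Continuous F) (hu : IsClassicalSolution F x₀ u) {s t : ℝ}
    (hs : 0 ≤ s) (ht : 0 ≤ t) : ∫ r in s..t, F (u r) = u t - u s := by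
  refine intervalIntegral.integral_eq_sub_of_hasDeriv_right
    (continuousOn_uIcc hu.continuousOn hs ht) (fun r hr => ?_)
    (continuousOn_uIcc (hu.continuousOn_field hF) hs ht).intervalIntegrable
  exact (hu.hasDerivAt ((le_min hs ht).trans_lt hr.1)).hasDerivWithinAt

/-- Control of increments by the dissipation, in the form of Young's inequality. -/
theorem norm_sub_le (hF : Continuous F) (hu : IsClassicalSolution F x₀ u) {s t T l : ℝ}
    (hs : 0 ≤ s) (hst : s ≤ t) (htT : t ≤ T) (hl : 0 < l) :
    ‖u t - u s‖ ≤ l / 2 * (∫ r in (0 : ℝ)..T, ‖F (u r)‖ ^ 2) + (t - s) / (2 * l) := by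
  have hcont := (hu.continuousOn_field hF)
  have hn : ContinuousOn (fun r => ‖F (u r)‖) (Ici 0) := hcont.norm
  have hn2 : ContinuousOn (fun r => ‖F (u r)‖ ^ 2) (Ici 0) := hn.pow 2
  have ht : 0 ≤ t := hs.trans hst
  have hT : 0 ≤ T := ht.trans htT
  have hint2 := (continuousOn_uIcc hn2 hs ht).intervalIntegrable (μ := volume)
  calc ‖u t - u s‖ = ‖∫ r in s..t, F (u r)‖ := by rw [hu.integral_field hF hs ht]
    _ ≤ ∫ r in s..t, ‖F (u r)‖ := intervalIntegral.norm_integral_le_integral_norm hst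
    -- The weight `l` stays free: a small `l` makes the energy term small, at the price of a short
    -- time window.
    _ ≤ ∫ r in s..t, (l / 2 * ‖F (u r)‖ ^ 2 + 1 / (2 * l)) := by
        refine intervalIntegral.integral_mono_on hst
          (continuousOn_uIcc hn hs ht).intervalIntegrable
          ((hint2.const_mul _).add intervalIntegrable_const) fun r _ => ?_
        have h : l / 2 * ‖F (u r)‖ ^ 2 + 1 / (2 * l) - ‖F (u r)‖
            = (l * ‖F (u r)‖ - 1) ^ 2 / (2 * l) := by
          field_simp
          ring
        have : 0 ≤ (l * ‖F (u r)‖ - 1) ^ 2 / (2 * l) := by positivity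
        linarith
    _ = l / 2 * (∫ r in s..t, ‖F (u r)‖ ^ 2) + (t - s) / (2 * l) := by
        rw [intervalIntegral.integral_add (hint2.const_mul _) intervalIntegrable_const,
          intervalIntegral.integral_const_mul, intervalIntegral.integral_const, smul_eq_mul,
          mul_one_div]
    _ ≤ _ := by
        gcongr
        exact intervalIntegral.integral_mono_interval hs hst htT
          (Eventually.of_forall fun r => by positivity)
          (continuousOn_uIcc hn2 le_rfl hT).intervalIntegrable

/-- Energy identity for gradient flows. -/
theorem integral_norm_sq_field (hF : Continuous F) (hu : IsClassicalSolution F x₀ u)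
    {V : Phase N → ℝ} (hV : ∀ x, HasGradientAt V (-F x) x) {t : ℝ} (ht : 0 ≤ t) :
    ∫ s in (0 : ℝ)..t, ‖F (u s)‖ ^ 2 = V x₀ - V (u t) := by
  have hcV : Continuous V := continuous_iff_continuousAt.2 fun x => (hV x).hasFDerivAt.continuousAt
  have hd : ∀ s ∈ Ioo (min 0 t) (max 0 t),
      HasDerivWithinAt (fun r => V (u r)) (-‖F (u s)‖ ^ 2) (Ioi s) s := fun s hs => by
    have h1 := (hV (u s)).hasFDerivAt.comp_hasDerivAt s
      (hu.hasDerivAt (by simpa [ht] using hs.1))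
    rw [InnerProductSpace.toDual_apply_apply, inner_neg_left, real_inner_self_eq_norm_sq] at h1
    exact h1.hasDerivWithinAt
  have hn2 : ContinuousOn (fun r => -‖F (u r)‖ ^ 2) (Ici 0) :=
    ((hu.continuousOn_field hF).norm.pow 2).neg
  have h := intervalIntegral.integral_eq_sub_of_hasDeriv_right
    (continuousOn_uIcc (hcV.comp_continuousOn hu.continuousOn) le_rfl ht) hd
    (continuousOn_uIcc hn2 le_rfl ht).intervalIntegrable
  rw [intervalIntegral.integral_neg, Function.comp_apply, Function.comp_apply, hu.1] at h
  linarith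

end IsClassicalSolution

/-- Energy estimate for the flow of a continuous odd kernel with nonnegative primitive. -/
theorem energy_estimate {k : ℝ → ℝ} (hk : ∀ x, k (-x) = -k x) (hcont : Continuous k)
    (hpos : ∀ θ, 0 ≤ ∫ s in (0 : ℝ)..θ, k s) {Ω x₀ : Phase N} {K : ℝ} (hK : 0 ≤ K)
    {u : ℝ → Phase N} (hu : IsClassicalSolution (vectorField Ω K k) x₀ u) {t : ℝ} (ht : 0 ≤ t) :
    1 / 2 * (∫ s in (0 : ℝ)..t, ‖vectorField Ω K k (u s)‖ ^ 2) ≤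
      ‖Ω‖ ^ 2 / 2 * t + interactionPotential K k x₀ := by
  have hF := continuous_vectorField hcont Ω K
  have hE := hu.integral_norm_sq_field hF (hasGradientAt_potential hk hcont Ω K) ht
  have hnn := interactionPotential_nonneg hK hpos (u t)
  have hc := hu.continuousOn_field hF
  -- The work of the drift is the integral of `⟪Ω, u'⟫`. Young's inequality spends half of the
  -- dissipation on it, leaving the factor `1 / 2` in the estimate.
  have hlin : ∑ i, Ω i * u t i - ∑ i, Ω i * x₀ i
      ≤ ‖Ω‖ ^ 2 / 2 * t + 1 / 2 * ∫ s in (0 : ℝ)..t, ‖vectorField Ω K k (u s)‖ ^ 2 := by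
    have hn2 : IntervalIntegrable (fun r => ‖vectorField Ω K k (u r)‖ ^ 2) volume 0 t :=
      (IsClassicalSolution.continuousOn_uIcc (hc.norm.pow 2) le_rfl ht).intervalIntegrable
    have hi : IntervalIntegrable (fun r => inner ℝ Ω (vectorField Ω K k (u r))) volume 0 t :=
      (IsClassicalSolution.continuousOn_uIcc (continuousOn_const.inner hc)
        le_rfl ht).intervalIntegrable
    calc ∑ i, Ω i * u t i - ∑ i, Ω i * x₀ i = inner ℝ Ω (u t - u 0) := by
          rw [inner_sub_right, hu.1]
          simp only [PiLp.inner_apply, RCLike.inner_apply, conj_trivial, mul_comm]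
      _ = ∫ s in (0 : ℝ)..t, inner ℝ Ω (vectorField Ω K k (u s)) := by
          rw [← hu.integral_field hF le_rfl ht]
          exact (ContinuousLinearMap.intervalIntegral_comp_comm (innerSL ℝ Ω)
            (IsClassicalSolution.continuousOn_uIcc hc le_rfl ht).intervalIntegrable).symm
      _ ≤ ∫ s in (0 : ℝ)..t, (‖Ω‖ ^ 2 / 2 + 1 / 2 * ‖vectorField Ω K k (u s)‖ ^ 2) := by
          refine intervalIntegral.integral_mono_on ht hi
            (intervalIntegrable_const.add (hn2.const_mul _)) fun s _ => ?_
          have h1 := real_inner_le_norm Ω (vectorField Ω K k (u s))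
          nlinarith [sq_nonneg (‖Ω‖ - ‖vectorField Ω K k (u s)‖)]
      _ = _ := by
          rw [intervalIntegral.integral_add intervalIntegrable_const (hn2.const_mul _),
            intervalIntegral.integral_const_mul, intervalIntegral.integral_const, smul_eq_mul,
            sub_zero, mul_comm t]
  rw [potential, potential] at hE
  linarith

/-! ### The Filippov map of the supercritical singular field -/

/-- In the supercritical regime the kernel blows up at the origin. -/
theorem tendsto_singKernel_nhdsGT_zero {α c : ℝ} (hc : 0 < c) (hα : 1 / 2 < α) :
    Tendsto (singKernel α c) (𝓝[>] 0) atTop := by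
  have hc' : 0 < c ^ α := Real.rpow_pos_of_pos hc _
  -- Minorant from Jordan's inequality `2 / π * s ≤ sin s`; its exponent is negative since `α >
  -- 1/2`.
  have hlim : Tendsto (fun s : ℝ => 2 / Real.pi * (c ^ α)⁻¹ * s ^ (1 - 2 * α)) (𝓝[>] 0) atTop := by
    refine Tendsto.const_mul_atTop (by have := Real.pi_pos; positivity) ?_
    have h := tendsto_rpow_neg_nhdsGT_zero (y := 1 - 2 * α) (by linarith)
    exact h
  refine tendsto_atTop_mono' _ ?_ hlim
  have hp : (0 : ℝ) < Real.pi / 2 := by have := Real.pi_pos; positivity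
  filter_upwards [Ioo_mem_nhdsGT hp] with s hs
  have h5 : 0 ≤ s ^ (2 * α) := Real.rpow_nonneg hs.1.le _
  rw [singKernel, orthoDist_of_mem_Icc ⟨hs.1.le, by linarith [hs.2]⟩, Real.rpow_sub hs.1,
    Real.rpow_one, mul_comm (c ^ α), ← div_div, div_eq_mul_inv (Real.sin s / _),
    mul_right_comm, ← mul_div_assoc]
  gcongr
  exact Real.mul_le_sin hs.1.le hs.2.le

/-- By oddness only `|a|` matters, so all blowing-up pairs tend to `+∞` and cannot cancel each
other. -/
theorem tendsto_mul_singKernel_mul {α c : ℝ} (hc : 0 < c) (hα : 1 / 2 < α) {a : ℝ}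
    (ha : a ≠ 0) : Tendsto (fun r => a * singKernel α c (r * a)) (𝓝[>] 0) atTop := by
  have habs : ∀ r, a * singKernel α c (r * a) = |a| * singKernel α c (r * |a|) := fun r => by
    rcases abs_choice a with h | h
    · rw [h]
    · rw [h, mul_neg, singKernel_eq_regKernel_zero α hc.le, regKernel_neg, neg_mul_neg]
  simp_rw [habs]
  have ha' : 0 < |a| := abs_pos.2 ha
  refine Tendsto.const_mul_atTop ha' ((tendsto_singKernel_nhdsGT_zero hc hα).comp ?_)
  refine tendsto_nhdsWithin_iff.2 ⟨?_, ?_⟩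
  · have : Tendsto (fun r : ℝ => r * |a|) (𝓝 0) (𝓝 (0 * |a|)) := by
      exact Continuous.tendsto (by fun_prop) 0
    rw [zero_mul] at this
    exact this.mono_left nhdsWithin_le_nhds
  · filter_upwards [self_mem_nhdsWithin] with r hr
    exact mul_pos hr ha'

/-- The component of the field in a direction `w` is jointly continuous in the regularization
parameter and the state as long as the pairs separated by `w` do not collide. -/
theorem continuousAt_inner_vectorField (α : ℝ) {c : ℝ} (hc : 0 < c) (Ω : Phase N) (K ε : ℝ)
    {w y : Phase N} (h : ∀ i j, w i ≠ w j → Real.cos (y j - y i) ≠ 1) :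
    ContinuousAt (fun p : ℝ × Phase N => inner ℝ w (vectorField Ω K (regKernel α c p.1) p.2))
      (ε, y) := by
  simp_rw [fun p : ℝ × Phase N => inner_vectorField (regKernel_neg α c p.1) Ω K w p.2]
  refine continuousAt_const.add (continuousAt_const.mul ?_)
  refine tendsto_finsetSum _ fun i _ => tendsto_finsetSum _ fun j _ => ?_
  -- Pairs not separated by `w` have coefficient zero, whether or not they collide.
  by_cases hij : w i = w j
  · simp only [hij, sub_self, zero_mul]
    exact tendsto_const_nhds
  · refine continuousAt_const.mul ?_
    exact (continuousAt_regKernel α hc (Or.inr (h i j hij)) :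
      ContinuousAt _ (ε, y j - y i)).comp (x := (ε, y))
      (f := fun p : ℝ × Phase N => (p.1, p.2 j - p.2 i)) (by fun_prop)

theorem continuousAt_inner_vectorField_singKernel (α : ℝ) {c : ℝ} (hc : 0 < c) (Ω : Phase N)
    (K : ℝ) {w y : Phase N} (h : ∀ i j, w i ≠ w j → Real.cos (y j - y i) ≠ 1) :
    ContinuousAt (fun z : Phase N => inner ℝ w (vectorField Ω K (singKernel α c) z)) y := by
  rw [singKernel_eq_regKernel_zero α hc.le]
  exact (continuousAt_inner_vectorField α hc Ω K 0 h).comp (f := fun z : Phase N => ((0 : ℝ), z))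
    (by fun_prop)

theorem tendsto_sum_atTop_of_eventually_le {ι β : Type*} [DecidableEq ι] {l : Filter β}
    {s : Finset ι} {f : ι → β → ℝ} {i₀ : ι} (hi₀ : i₀ ∈ s) (h₀ : Tendsto (f i₀) l atTop)
    (h : ∀ i, ∃ B : ℝ, ∀ᶠ b in l, B ≤ f i b) :
    Tendsto (fun b => ∑ i ∈ s, f i b) l atTop := by
  choose B hB using h
  simp_rw [← Finset.add_sum_erase s _ hi₀]
  refine tendsto_atTop_add_right_of_le' l (∑ i ∈ s.erase i₀, B i) h₀ ?_
  have : ∀ᶠ b in l, ∀ i ∈ s.erase i₀, B i ≤ f i b :=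
    (Finset.eventually_all _).2 fun i _ => hB i
  filter_upwards [this] with b hb
  exact Finset.sum_le_sum hb

/-- Moving along a direction `w` that is not constant on clusters, the component of the singular
field along `w` is unbounded. -/
theorem tendsto_inner_vectorField_singKernel {α c K : ℝ} (hc : 0 < c) (hα : 1 / 2 < α)
    (hK : 0 < K) (Ω : Phase N) {w x : Phase N} {i₀ j₀ : Fin N}
    (hcos : Real.cos (x j₀ - x i₀) = 1) (hw : w i₀ ≠ w j₀) :
    Tendsto (fun r : ℝ => inner ℝ w (vectorField Ω K (singKernel α c) (x - r • w)))
      (𝓝[>] 0) atTop := by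
  have hN : (0 : ℝ) < N := by exact_mod_cast i₀.pos
  have hodd : ∀ θ, singKernel α c (-θ) = -singKernel α c θ := fun θ => by
    rw [singKernel_eq_regKernel_zero α hc.le, regKernel_neg]
  have hper : Function.Periodic (singKernel α c) (2 * Real.pi) := by
    rw [singKernel_eq_regKernel_zero α hc.le]; exact regKernel_periodic α c 0
  simp_rw [inner_vectorField hodd]
  refine tendsto_atTop_add_const_left _ _ (Tendsto.const_mul_atTop (by positivity) ?_)
  -- For a collided pair the phase difference is `r * (w i - w j)` up to a multiple of `2π`, which
  -- periodicity removes.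
  have hcluster : ∀ i j, Real.cos (x j - x i) = 1 → ∀ r : ℝ,
      (w i - w j) * singKernel α c ((x - r • w) j - (x - r • w) i) =
        (w i - w j) * singKernel α c (r * (w i - w j)) := fun i j hij r => by
    obtain ⟨n, hn⟩ := (Real.cos_eq_one_iff _).1 hij
    rw [← hper.zsmul n (r * (w i - w j)), zsmul_eq_mul, hn]
    congr 2
    simp only [PiLp.sub_apply, PiLp.smul_apply, smul_eq_mul]
    ring
  simp_rw [← Finset.univ.sum_product' Finset.univ
    (fun i j => (w i - w j) * singKernel α c ((x - _ • w) j - (x - _ • w) i))]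
  refine tendsto_sum_atTop_of_eventually_le
    (f := fun (p : Fin N × Fin N) (r : ℝ) =>
      (w p.1 - w p.2) * singKernel α c ((x - r • w) p.2 - (x - r • w) p.1))
    (i₀ := (i₀, j₀)) (by simp) ?_ ?_
  · simp_rw [hcluster i₀ j₀ hcos]
    exact tendsto_mul_singKernel_mul hc hα (sub_ne_zero.2 hw)
  -- Other collided pairs vanish or blow up to `+∞`; pairs not collided converge. All are bounded
  -- below near `r = 0`.
  · rintro ⟨i, j⟩
    by_cases hij : Real.cos (x j - x i) = 1
    · refine ⟨0, ?_⟩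
      simp_rw [hcluster i j hij]
      rcases eq_or_ne (w i) (w j) with h | h
      · simp [h]
      · exact (tendsto_mul_singKernel_mul hc hα (sub_ne_zero.2 h)).eventually_ge_atTop 0
    · have hk : ContinuousAt (singKernel α c) (x j - x i) := by
        rw [singKernel_eq_regKernel_zero α hc.le]
        exact (continuousAt_regKernel α hc (Or.inr hij) :
          ContinuousAt _ ((0 : ℝ), x j - x i)).comp (f := fun t : ℝ => ((0 : ℝ), t)) (by fun_prop)
      have harg : Tendsto (fun r : ℝ => (x - r • w) j - (x - r • w) i) (𝓝[>] 0)
          (𝓝 (x j - x i)) := by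
        have : Continuous fun r : ℝ => (x - r • w) j - (x - r • w) i := by fun_prop
        have := this.tendsto 0
        simp only [zero_smul, sub_zero] at this
        exact this.mono_left nhdsWithin_le_nhds
      have hT := (hk.tendsto.comp harg).const_mul (w i - w j)
      exact ⟨_, hT.eventually (Ici_mem_nhds (sub_one_lt _))⟩

/-- A vector whose pairings with all directions constant on clusters agree with those of the
singular field belongs to the Filippov set. -/
theorem mem_filippovMap_of_inner_eq {α c K : ℝ} (hc : 0 < c) (hα : 1 / 2 < α) (hK : 0 < K)
    (Ω : Phase N) {x v : Phase N}
    (hv : ∀ w : Phase N, (∀ i j, Real.cos (x j - x i) = 1 → w i = w j) →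
      inner ℝ w v = inner ℝ w (vectorField Ω K (singKernel α c) x)) :
    v ∈ filippovMap (vectorField Ω K (singKernel α c)) x := by
  intro δ hδ S hS
  by_contra hmem
  obtain ⟨f, a, hfa, hav⟩ := geometric_hahn_banach_closed_point
    (convex_convexHull ℝ _).closure isClosed_closure hmem
  obtain ⟨w, rfl⟩ := (InnerProductSpace.toDual ℝ (Phase N)).surjective f
  simp only [InnerProductSpace.toDual_apply_apply] at hfa hav
  -- One point of the ball that violates the separation suffices, provided the pairing is continuous
  -- there: the violation then holds on a neighbourhood, which the null set `S` cannot cover.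
  obtain ⟨y, hy, hsep, hay⟩ : ∃ y ∈ Metric.ball x δ,
      (∀ i j, w i ≠ w j → Real.cos (y j - y i) ≠ 1) ∧
      a < inner ℝ w (vectorField Ω K (singKernel α c) y) := by
    by_cases hw : ∀ i j, Real.cos (x j - x i) = 1 → w i = w j
    · exact ⟨x, Metric.mem_ball_self hδ, fun i j => mt (hw i j), by rwa [← hv w hw]⟩
    push Not at hw
    obtain ⟨i₀, j₀, hcos, hne⟩ := hw
    have h1 := (tendsto_inner_vectorField_singKernel hc hα hK Ω hcos hne).eventually_gt_atTop a
    have hcont : Continuous fun r : ℝ => x - r • w := by fun_prop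
    have h2 : ∀ᶠ r in 𝓝[>] (0 : ℝ), x - r • w ∈ Metric.ball x δ := by
      refine nhdsWithin_le_nhds (hcont.continuousAt.preimage_mem_nhds ?_)
      simpa using Metric.ball_mem_nhds x hδ
    have h3 : ∀ᶠ r in 𝓝[>] (0 : ℝ), ∀ i j, w i ≠ w j →
        Real.cos ((x - r • w) j - (x - r • w) i) ≠ 1 := by
      refine eventually_all.2 fun i => eventually_all.2 fun j => eventually_imp_distrib_left.2 ?_
      intro hij
      have hr : ∀ r : ℝ, (x - r • w) j - (x - r • w) i = (x j - x i) + r * (w i - w j) :=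
        fun r => by simp only [PiLp.sub_apply, PiLp.smul_apply, smul_eq_mul]; ring
      simp_rw [hr]
      by_cases hc1 : Real.cos (x j - x i) = 1
      · obtain ⟨n, hn⟩ := (Real.cos_eq_one_iff _).1 hc1
        have hd : 0 < |w i - w j| := abs_pos.2 (sub_ne_zero.2 hij)
        -- A nonzero displacement shorter than `2π` undoes the collision.
        filter_upwards [Ioo_mem_nhdsGT (div_pos Real.two_pi_pos hd)] with r hr
        have hlt : |r * (w i - w j)| < 2 * Real.pi := by
          rw [abs_mul, abs_of_pos hr.1]
          exact (lt_div_iff₀ hd).1 hr.2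
        rw [← hn, add_comm, Real.cos_add_int_mul_two_pi, Ne,
          Real.cos_eq_one_iff_of_lt_of_lt (abs_lt.1 hlt).1 (abs_lt.1 hlt).2]
        exact mul_ne_zero hr.1.ne' (sub_ne_zero.2 hij)
      · have hcc : ContinuousAt (fun r : ℝ => Real.cos ((x j - x i) + r * (w i - w j))) 0 := by
          fun_prop
        refine nhdsWithin_le_nhds (hcc.eventually_ne ?_)
        simpa using hc1
    obtain ⟨r, ha, hb, hs⟩ := (h1.and (h2.and h3)).exists
    exact ⟨_, hb, hs, ha⟩
  have hnear : ∀ᶠ z in 𝓝 y, z ∈ Metric.ball x δ ∧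
      a < inner ℝ w (vectorField Ω K (singKernel α c) z) :=
    (Metric.isOpen_ball.eventually_mem hy).and
      ((continuousAt_inner_vectorField_singKernel α hc Ω K hsep).eventually (lt_mem_nhds hay))
  obtain ⟨z, ⟨hzb, hza⟩, hzS⟩ : ∃ z, (z ∈ Metric.ball x δ ∧
      a < inner ℝ w (vectorField Ω K (singKernel α c) z)) ∧ z ∉ S := by
    by_contra! hcon
    exact (Measure.measure_pos_of_mem_nhds volume hnear).ne'
      (measure_mono_null (fun z hz => hcon z hz) hS)
  exact (hfa _ (subset_closure (subset_convexHull ℝ _ ⟨z, ⟨hzb, hzS⟩, rfl⟩))).not_gt hza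

/-! ### Classical solutions as elements of `H¹` -/

theorem memLp_of_continuousOn_Ici {f : ℝ → Phase N} (hf : ContinuousOn f (Ici 0)) (T : ℝ) :
    MemLp f 2 (volume.restrict (Ioo (0 : ℝ) T)) := by
  have hI : ContinuousOn f (Icc 0 T) := hf.mono fun _ h => h.1
  obtain ⟨C, hC⟩ := isCompact_Icc.exists_bound_of_continuousOn hI
  refine MemLp.of_bound ((hI.mono Ioo_subset_Icc_self).aestronglyMeasurable measurableSet_Ioo) C ?_
  filter_upwards [ae_restrict_mem measurableSet_Ioo] with t ht
  exact hC t (Ioo_subset_Icc_self ht)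

theorem norm_sq_toLp {f : ℝ → Phase N} {T : ℝ} (hT : 0 ≤ T)
    (hf : MemLp f 2 (volume.restrict (Ioo (0 : ℝ) T))) :
    ‖hf.toLp f‖ ^ 2 = ∫ t in (0 : ℝ)..T, ‖f t‖ ^ 2 := by
  rw [← real_inner_self_eq_norm_sq, L2.inner_def, intervalIntegral.integral_of_le hT,
    integral_Ioc_eq_integral_Ioo]
  refine integral_congr_ae ?_
  filter_upwards [hf.coeFn_toLp] with t ht
  rw [ht, real_inner_self_eq_norm_sq]

namespace IsClassicalSolution

variable {F : Phase N → Phase N} {x₀ : Phase N} {u : ℝ → Phase N}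

theorem integral_deriv_smul (hF : Continuous F) (hu : IsClassicalSolution F x₀ u) {T : ℝ}
    (hT : 0 ≤ T) {φ : ℝ → ℝ} (hφ : IsTestFunction T φ) :
    ∫ t in Ioo 0 T, deriv φ t • u t = -∫ t in Ioo 0 T, φ t • F (u t) := by
  have hφ0 : ∀ t, t ∉ Ioo 0 T → φ t = 0 := fun t ht =>
    image_eq_zero_of_notMem_tsupport fun h => ht (hφ.2.2 h)
  have hdc : Continuous (deriv φ) := hφ.1.continuous_deriv (by simp)
  have h := intervalIntegral.integral_smul_deriv_eq_deriv_smul_of_hasDerivAt (a := 0) (b := T)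
    (u := φ) (u' := deriv φ) (v := u) (v' := fun t => F (u t))
    hφ.1.continuous.continuousOn (continuousOn_uIcc hu.continuousOn le_rfl hT)
    (fun t _ => (hφ.1.differentiable (by simp) t).hasDerivAt)
    (fun t ht => hu.hasDerivAt (by simpa [hT] using ht.1))
    (hdc.intervalIntegrable _ _)
    (continuousOn_uIcc (hu.continuousOn_field hF) le_rfl hT).intervalIntegrable
  rw [hφ0 T (by simp), hφ0 0 (by simp), zero_smul, zero_smul, sub_zero, zero_sub,
    intervalIntegral.integral_of_le hT, intervalIntegral.integral_of_le hT,
    integral_Ioc_eq_integral_Ioo, integral_Ioc_eq_integral_Ioo] at h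
  rw [h, neg_neg]

/-- The element of `H¹((0,T))` given by a classical solution. -/
theorem exists_representsH1 (hF : Continuous F) (hu : IsClassicalSolution F x₀ u) {T : ℝ}
    (hT : 0 ≤ T) : ∃ p : H1 N T, RepresentsH1 p u ∧
      ‖p‖ ^ 2 = (∫ t in (0 : ℝ)..T, ‖u t‖ ^ 2) + ∫ t in (0 : ℝ)..T, ‖F (u t)‖ ^ 2 := by
  have h1 := memLp_of_continuousOn_Ici hu.continuousOn T
  have h2 := memLp_of_continuousOn_Ici (hu.continuousOn_field hF) T
  refine ⟨⟨WithLp.toLp 2 (h1.toLp _, h2.toLp _), fun φ hφ => ?_⟩, h1.coeFn_toLp.symm, ?_⟩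
  · have e1 : ∫ t in Ioo 0 T, deriv φ t • (h1.toLp u) t = ∫ t in Ioo 0 T, deriv φ t • u t :=
      integral_congr_ae (by filter_upwards [h1.coeFn_toLp] with t ht; rw [ht])
    have e2 : ∫ t in Ioo 0 T, φ t • (h2.toLp fun t => F (u t)) t
        = ∫ t in Ioo 0 T, φ t • F (u t) :=
      integral_congr_ae (by filter_upwards [h2.coeFn_toLp] with t ht; rw [ht])
    change ∫ t in Ioo 0 T, deriv φ t • (h1.toLp u) t
      = -∫ t in Ioo 0 T, φ t • (h2.toLp fun t => F (u t)) t
    rw [e1, e2, hu.integral_deriv_smul hF hT hφ]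
  · rw [← norm_sq_toLp hT h1, ← norm_sq_toLp hT h2]
    exact WithLp.prod_norm_sq_eq_of_L2 _

/-- The weak derivative of a classical solution is its classical derivative. -/
theorem snd_ae_eq (hF : Continuous F) (hu : IsClassicalSolution F x₀ u) {T : ℝ} (hT : 0 ≤ T)
    {p : H1 N T} (hp : RepresentsH1 p u) :
    p.1.snd =ᵐ[volume.restrict (Ioo (0 : ℝ) T)] fun t => F (u t) := by
  have h2 := memLp_of_continuousOn_Ici (hu.continuousOn_field hF) T
  have hi1 : IntegrableOn p.1.snd (Ioo 0 T) := (Lp.memLp p.1.snd).integrable (by norm_num)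
  have hi2 : IntegrableOn (fun t => F (u t)) (Ioo 0 T) := h2.integrable (by norm_num)
  have key := isOpen_Ioo.ae_eq_zero_of_integral_contDiff_smul_eq_zero
    (f := fun t => p.1.snd t - F (u t)) (U := Ioo (0 : ℝ) T) (μ := volume)
    (hi1.sub hi2).locallyIntegrableOn ?_
  · filter_upwards [ae_restrict_of_ae key, ae_restrict_mem measurableSet_Ioo] with t ht hm
    exact sub_eq_zero.1 (ht hm)
  · intro g hg hgc hgs
    have hs : ∫ t, g t • (p.1.snd t - F (u t))
        = ∫ t in Ioo 0 T, g t • (p.1.snd t - F (u t)) := by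
      refine (setIntegral_eq_integral_of_forall_compl_eq_zero fun t ht => ?_).symm
      rw [image_eq_zero_of_notMem_tsupport fun h => ht (hgs h), zero_smul]
    have hpφ := p.2 g ⟨hg, hgc, hgs⟩
    have e1 : ∫ t in Ioo 0 T, deriv g t • p.1.fst t = ∫ t in Ioo 0 T, deriv g t • u t :=
      integral_congr_ae (by filter_upwards [hp] with t ht; rw [ht])
    rw [e1, hu.integral_deriv_smul hF hT ⟨hg, hgc, hgs⟩, neg_inj] at hpφ
    have e2 : ∫ t in Ioo 0 T, g t • F (u t)
        = ∫ t in Ioo 0 T, g t • (h2.toLp fun t => F (u t)) t :=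
      integral_congr_ae (by filter_upwards [h2.coeFn_toLp] with t ht; rw [ht])
    have hi3 : Integrable (fun t => g t • F (u t)) (volume.restrict (Ioo (0 : ℝ) T)) :=
      (integrable_smul_L2 hg.continuous hgc (h2.toLp fun t => F (u t))).congr
        (by filter_upwards [h2.coeFn_toLp] with t ht; rw [ht])
    rw [hs]
    simp_rw [smul_sub]
    rw [integral_sub (integrable_smul_L2 hg.continuous hgc _) hi3, hpφ, sub_self]

end IsClassicalSolution

/-! ### Weak limits -/

theorem tendsto_of_forall_inner {ι : Type*} {l : Filter ι} {a : ι → Phase N} {b : Phase N}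
    (h : ∀ e : Phase N, Tendsto (fun n => inner ℝ e (a n)) l (𝓝 (inner ℝ e b))) :
    Tendsto a l (𝓝 b) := by
  have hpi : Tendsto (fun n => (a n).ofLp) l (𝓝 b.ofLp) := by
    refine tendsto_pi_nhds.2 fun i => ?_
    simpa [EuclideanSpace.inner_single_left] using h (EuclideanSpace.single i 1)
  exact ((PiLp.continuous_toLp 2 _).tendsto b.ofLp).comp hpi

/-- Weak convergence in `H¹` implies convergence of averages of the functions and of their weak
derivatives. -/
theorem tendsto_setIntegral_of_weak {T : ℝ} {p : ℕ → H1 N T} {q : H1 N T}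
    (h : ∀ ℓ : H1 N T →L[ℝ] ℝ, Tendsto (fun n => ℓ (p n)) atTop (𝓝 (ℓ q)))
    (π : WithLp 2 (L2 N T × L2 N T) →L[ℝ] L2 N T) {A : Set ℝ} (hA : MeasurableSet A) :
    Tendsto (fun n => ∫ t in A, π (p n).1 t ∂(volume.restrict (Ioo (0 : ℝ) T))) atTop
      (𝓝 (∫ t in A, π q.1 t ∂(volume.restrict (Ioo (0 : ℝ) T)))) := by
  refine tendsto_of_forall_inner fun e => ?_
  have hμ : volume.restrict (Ioo (0 : ℝ) T) A ≠ ⊤ := measure_ne_top _ _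
  -- Test against `e` times the indicator of `A`; `π` will be one of the two coordinate projections.
  have := h (innerSL ℝ (indicatorConstLp 2 hA hμ e) ∘L π ∘L (H1 N T).subtypeL)
  simpa only [ContinuousLinearMap.comp_apply, Submodule.subtypeL_apply, innerSL_apply_apply,
    L2.inner_indicatorConstLp_eq_inner_setIntegral] using this

/-- Reduces a vector-valued primitive of `f` to the scalar primitive of `‖f‖`. -/
theorem absolutelyContinuousOnInterval_of_dist_le {X Y : Type*} [PseudoMetricSpace X]
    [PseudoMetricSpace Y] {f : ℝ → X} {g : ℝ → Y} {a b : ℝ}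
    (hg : AbsolutelyContinuousOnInterval g a b)
    (h : ∀ x ∈ uIcc a b, ∀ y ∈ uIcc a b, dist (f x) (f y) ≤ dist (g x) (g y)) :
    AbsolutelyContinuousOnInterval f a b := by
  rw [absolutelyContinuousOnInterval_iff] at hg ⊢
  intro η hη
  obtain ⟨δ, hδ, hE⟩ := hg η hη
  refine ⟨δ, hδ, fun E hEd hlt => (Finset.sum_le_sum fun i hi => ?_).trans_lt (hE E hEd hlt)⟩
  exact h _ (hEd.1 i hi).1 _ (hEd.1 i hi).2

/-- The primitive of an integrable vector-valued function is absolutely continuous. -/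
theorem absolutelyContinuousOnInterval_primitive {f : ℝ → Phase N} {T : ℝ}
    (hf : IntervalIntegrable f volume 0 T) (x₀ : Phase N) :
    AbsolutelyContinuousOnInterval (fun t => x₀ + ∫ s in (0 : ℝ)..t, f s) 0 T := by
  refine absolutelyContinuousOnInterval_of_dist_le
    (hf.norm.absolutelyContinuousOnInterval_intervalIntegral (c := 0) left_mem_uIcc) ?_
  intro x hx y hy
  have hsub : ∀ z ∈ uIcc 0 T, IntervalIntegrable f volume 0 z := fun z hz =>
    hf.mono_set (uIcc_subset_uIcc left_mem_uIcc hz)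
  rw [dist_add_left, dist_comm, dist_eq_norm,
    intervalIntegral.integral_interval_sub_left (hsub y hy) (hsub x hx), dist_comm,
    Real.dist_eq, intervalIntegral.integral_interval_sub_left (hsub y hy).norm (hsub x hx).norm]
  exact intervalIntegral.norm_integral_le_abs_integral_norm

namespace IsWeakH1LocLimit

variable {F : ℕ → Phase N → Phase N} {x₀ : Phase N} {u : ℕ → ℝ → Phase N} {v v' : ℝ → Phase N}

theorem intervalIntegrable (h : IsWeakH1LocLimit u v v') {t : ℝ} (ht : 0 ≤ t) :
    IntervalIntegrable v' volume 0 t := by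
  rcases ht.eq_or_lt with rfl | ht
  · exact IntervalIntegrable.refl
  obtain ⟨p, q, -, -, hq, -⟩ := h t ht
  rw [intervalIntegrable_iff_integrableOn_Ioo_of_le ht.le]
  exact ((Lp.memLp q.1.snd).integrable (by norm_num)).congr hq.symm

/-- Weak limits of classical solutions are pointwise limits. -/
theorem tendsto_apply (h : IsWeakH1LocLimit u v v') (hF : ∀ n, Continuous (F n))
    (hu : ∀ n, IsClassicalSolution (F n) x₀ (u n)) {t : ℝ} (ht : 0 ≤ t) :
    Tendsto (fun n => u n t) atTop (𝓝 (x₀ + ∫ s in (0 : ℝ)..t, v' s)) := by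
  rcases ht.eq_or_lt with rfl | ht
  · simp [(hu _).1]
  obtain ⟨p, q, hp, -, hq, hweak⟩ := h t ht
  -- The integral of the weak derivative over `(0, t)` is the increment `u n t - x₀`, so weak
  -- convergence yields convergence at the time `t`.
  have key := tendsto_setIntegral_of_weak hweak (WithLp.sndL 2 ℝ (L2 N t) (L2 N t))
    MeasurableSet.univ
  simp only [Measure.restrict_univ, WithLp.sndL_apply] at key
  have e1 : ∀ n, ∫ s in Ioo 0 t, (p n).1.snd s = u n t - x₀ := fun n => by
    rw [integral_congr_ae ((hu n).snd_ae_eq (hF n) ht.le (hp n)), ← integral_Ioc_eq_integral_Ioo,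
      ← intervalIntegral.integral_of_le ht.le, (hu n).integral_field (hF n) le_rfl ht.le, (hu n).1]
  have e2 : ∫ s in Ioo 0 t, q.1.snd s = ∫ s in (0 : ℝ)..t, v' s := by
    rw [← integral_congr_ae hq, ← integral_Ioc_eq_integral_Ioo,
      ← intervalIntegral.integral_of_le ht.le]
  simp_rw [e1, e2] at key
  simpa using key.const_add x₀

theorem ae_restrict_Ioi_of_forall {P : ℝ → Prop}
    (h : ∀ T : ℝ, 0 < T → ∀ᵐ t ∂(volume.restrict (Ioo (0 : ℝ) T)), P t) :
    ∀ᵐ t ∂(volume.restrict (Ioi (0 : ℝ))), P t := by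
  have hU : Ioi (0 : ℝ) = ⋃ m : ℕ, Ioo 0 ((m : ℝ) + 1) := by
    ext t
    simp only [mem_Ioi, mem_iUnion, mem_Ioo]
    refine ⟨fun ht => ?_, fun ⟨_, ht, _⟩ => ht⟩
    obtain ⟨m, hm⟩ := exists_nat_gt t
    exact ⟨m, ht, by linarith⟩
  rw [hU, ae_restrict_iUnion_iff]
  exact fun m => h _ (by positivity)

/-- A weak limit of locally uniformly bounded classical solutions coincides almost everywhere with
the primitive of its weak derivative that has the common initial value. -/
theorem ae_eq_primitive (h : IsWeakH1LocLimit u v v') (hF : ∀ n, Continuous (F n))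
    (hu : ∀ n, IsClassicalSolution (F n) x₀ (u n))
    (hb : ∀ T : ℝ, 0 < T → ∃ C, ∀ n, ∀ t ∈ Icc 0 T, ‖u n t‖ ≤ C) :
    (fun t => x₀ + ∫ s in (0 : ℝ)..t, v' s) =ᵐ[volume.restrict (Ioi (0 : ℝ))] v := by
  refine ae_restrict_Ioi_of_forall fun T hT => ?_
  obtain ⟨C, hC⟩ := hb T hT
  obtain ⟨p, q, hp, hv, -, hweak⟩ := h T hT
  set μ := volume.restrict (Ioo (0 : ℝ) T) with hμ
  have hcont : ContinuousOn (fun t => x₀ + ∫ s in (0 : ℝ)..t, v' s) (Icc 0 T) := by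
    have := (absolutelyContinuousOnInterval_primitive (h.intervalIntegrable hT.le) x₀).continuousOn
    rwa [uIcc_of_le hT.le] at this
  have hint : Integrable (fun t => x₀ + ∫ s in (0 : ℝ)..t, v' s) μ :=
    (hcont.integrableOn_Icc).mono_set Ioo_subset_Icc_self
  have hqint : Integrable q.1.fst μ := (Lp.memLp q.1.fst).integrable (by norm_num)
  have heq : (fun t => x₀ + ∫ s in (0 : ℝ)..t, v' s) =ᵐ[μ] q.1.fst := by
    -- Over each `A` the integrals of `u n` have two limits, one by dominated convergence and one by
    -- weak convergence.
    refine hint.ae_eq_of_forall_setIntegral_eq _ _ hqint fun A hA _ => ?_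
    have key := tendsto_setIntegral_of_weak hweak (WithLp.fstL 2 ℝ (L2 N T) (L2 N T)) hA
    simp only [WithLp.fstL_apply] at key
    have e1 : ∀ n, ∫ s in A, (p n).1.fst s ∂μ = ∫ s in A, u n s ∂μ := fun n =>
      integral_congr_ae (ae_restrict_of_ae (hp n).symm)
    simp_rw [← hμ, e1] at key
    refine tendsto_nhds_unique ?_ key
    refine tendsto_integral_of_dominated_convergence (fun _ => C) (fun n => ?_)
      (integrable_const C) (fun n => ?_) ?_
    · exact (memLp_of_continuousOn_Ici (hu n).continuousOn T).1.restrict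
    · refine ae_restrict_of_ae ?_
      filter_upwards [ae_restrict_mem measurableSet_Ioo] with t ht
      exact hC n t (Ioo_subset_Icc_self ht)
    · refine ae_restrict_of_ae ?_
      filter_upwards [ae_restrict_mem measurableSet_Ioo] with t ht
      exact h.tendsto_apply hF hu ht.1.le
  exact heq.trans hv.symm

theorem ae_hasDerivAt_primitive (h : IsWeakH1LocLimit u v v') (x₀ : Phase N) :
    ∀ᵐ t ∂(volume.restrict (Ioi (0 : ℝ))),
      HasDerivAt (fun t => x₀ + ∫ s in (0 : ℝ)..t, v' s) (v' t) t := by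
  refine ae_restrict_Ioi_of_forall fun T hT => ?_
  filter_upwards [ae_restrict_of_ae (h.intervalIntegrable hT.le).ae_hasDerivAt_integral,
    ae_restrict_mem measurableSet_Ioo] with t ht hm
  have hmem : t ∈ uIcc 0 T := by rw [uIcc_of_le hT.le]; exact Ioo_subset_Icc_self hm
  exact (ht hmem 0 left_mem_uIcc).const_add x₀

end IsWeakH1LocLimit

/-- Identification of a component of the derivative of a pointwise limit of solutions with bounded
dissipation, in directions in which the fields converge locally uniformly. -/
theorem inner_deriv_eq_of_tendsto {F : ℕ → Phase N → Phase N} {x₀ : Phase N}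
    {u : ℕ → ℝ → Phase N} {Φ : ℝ → Phase N} (hF : ∀ n, Continuous (F n))
    (hu : ∀ n, IsClassicalSolution (F n) x₀ (u n))
    (hE : ∀ T : ℝ, 0 < T → ∃ E, ∀ n, ∫ r in (0 : ℝ)..T, ‖F n (u n r)‖ ^ 2 ≤ E)
    (hΦ : ∀ t, 0 ≤ t → Tendsto (fun n => u n t) atTop (𝓝 (Φ t))) {t : ℝ} (ht : 0 < t)
    {d : Phase N} (hd : HasDerivAt Φ d t) {w : Phase N} {L : ℝ}
    (hL : Tendsto (fun p : ℕ × Phase N => inner ℝ w (F p.1 p.2)) (atTop ×ˢ 𝓝 (Φ t)) (𝓝 L)) :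
    inner ℝ w d = L := by
  refine eq_of_forall_dist_le fun η hη => ?_
  obtain ⟨E, hE⟩ := hE (t + 1) (by linarith)
  have hev := (Metric.tendsto_nhds.1 hL) η hη
  obtain ⟨P, hP, Q, hQ, hPQ⟩ := eventually_prod_iff.1 hev
  obtain ⟨δ, hδ, hball⟩ := Metric.eventually_nhds_iff.1 hQ
  -- Budget for staying within `δ` of `Φ t`: `δ / 4` for the energy term, `δ / 2` for a time window
  -- of length `l * δ`, and `δ / 4` for the distance at time `t`. The window does not depend on `n`.
  set l := δ / (2 * (|E| + 1)) with hl
  have hl0 : 0 < l := by positivity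
  have hlE : l / 2 * E ≤ δ / 4 := by
    have h1 : l / 2 * E ≤ l / 2 * (|E| + 1) := by
      have := le_abs_self E
      gcongr
      linarith
    have h2 : l / 2 * (|E| + 1) = δ / 4 := by
      rw [hl]
      field_simp
      ring
    linarith
  -- Proved for `u n` with `n` large, then passed to the pointwise limit; no convergence of the
  -- derivatives is needed.
  have hslope : ∀ s ∈ Ioo t (t + min 1 (l * δ)),
      ‖inner ℝ w (Φ s - Φ t) - L * (s - t)‖ ≤ η * (s - t) := by
    intro s hs
    have hs0 : 0 ≤ s := ht.le.trans hs.1.le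
    have hs1 : s ≤ t + 1 := hs.2.le.trans (by gcongr; exact min_le_left _ _)
    have hs2 : s - t ≤ l * δ := by
      have := hs.2.trans_le (add_le_add_right (min_le_right 1 (l * δ)) t)
      linarith
    have hlim : Tendsto (fun n => ‖inner ℝ w (u n s - u n t) - L * (s - t)‖) atTop
        (𝓝 ‖inner ℝ w (Φ s - Φ t) - L * (s - t)‖) :=
      ((tendsto_const_nhds.inner ((hΦ s hs0).sub (hΦ t ht.le))).sub_const _).norm
    refine le_of_tendsto hlim ?_
    filter_upwards [hP, (Metric.tendsto_nhds.1 (hΦ t ht.le)) (δ / 4) (by positivity)] with n hPn hn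
    have hc := IsClassicalSolution.continuousOn_uIcc ((hu n).continuousOn_field (hF n)) ht.le hs0
    have hint : IntervalIntegrable (fun r => inner ℝ w (F n (u n r))) volume t s :=
      (continuousOn_const.inner hc).intervalIntegrable
    have e1 : inner ℝ w (u n s - u n t) - L * (s - t)
        = ∫ r in t..s, (inner ℝ w (F n (u n r)) - L) := by
      rw [intervalIntegral.integral_sub hint intervalIntegrable_const,
        intervalIntegral.integral_const, smul_eq_mul, mul_comm L,
        ← (hu n).integral_field (hF n) ht.le hs0]
      congr 1
      exact (ContinuousLinearMap.intervalIntegral_comp_comm (innerSL ℝ w)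
        hc.intervalIntegrable).symm
    rw [e1]
    have hbound := intervalIntegral.norm_integral_le_of_norm_le_const (a := t) (b := s) (C := η)
      (f := fun r => inner ℝ w (F n (u n r)) - L) ?_
    · rwa [abs_of_pos (sub_pos.2 hs.1)] at hbound
    intro r hr
    rw [uIoc_of_le hs.1.le] at hr
    have hclose : dist (u n r) (Φ t) < δ := by
      have h1 := (hu n).norm_sub_le (hF n) ht.le hr.1.le (hr.2.trans hs1) hl0
      have h2 : (r - t) / (2 * l) ≤ δ / 2 := by
        rw [div_le_iff₀ (by positivity)]
        have := hr.2
        nlinarith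
      have h3 : l / 2 * (∫ r in (0 : ℝ)..(t + 1), ‖F n (u n r)‖ ^ 2) ≤ l / 2 * E := by
        gcongr
        exact hE n
      have h4 := dist_triangle (u n r) (u n t) (Φ t)
      rw [dist_eq_norm (u n r) (u n t)] at h4
      linarith
    exact (hPQ hPn (hball hclose)).le
  have hg : HasDerivAt (fun s => (inner ℝ w (Φ s) : ℝ)) (inner ℝ w d) t := by
    simpa using (hasDerivAt_const t w).inner ℝ hd
  have hlim : Tendsto (fun s => ‖slope (fun s => (inner ℝ w (Φ s) : ℝ)) t s - L‖) (𝓝[>] t)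
      (𝓝 ‖inner ℝ w d - L‖) :=
    (((hasDerivAt_iff_tendsto_slope.1 hg).mono_left
      (nhdsWithin_mono t fun s hs => (ne_of_gt hs))).sub_const L).norm
  rw [dist_eq_norm]
  refine le_of_tendsto hlim ?_
  have hρ : t < t + min 1 (l * δ) := by
    have : 0 < min 1 (l * δ) := by positivity
    linarith
  filter_upwards [Ioo_mem_nhdsGT hρ] with s hs
  have hst : 0 < s - t := sub_pos.2 hs.1
  have h1 := hslope s hs
  have h2 : slope (fun s => (inner ℝ w (Φ s) : ℝ)) t s - L
      = (inner ℝ w (Φ s - Φ t) - L * (s - t)) / (s - t) := by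
    rw [slope_def_field, inner_sub_right]
    field_simp
  rw [h2, norm_div, Real.norm_of_nonneg hst.le, div_le_iff₀ hst]
  exact h1

/-! ### The regularized flows -/

/-- Energy estimate for the regularized flows, uniform in the regularization parameter. -/
theorem energy_estimate_regKernel {Ω x₀ : Phase N} {K c α ε : ℝ} (hK : 0 < K) (hc : 0 < c)
    (hα : α ∈ Ioo (1 / 2 : ℝ) 1) (hε : 0 < ε) {u : ℝ → Phase N}
    (hu : IsClassicalSolution (vectorField Ω K (regKernel α c ε)) x₀ u) {t : ℝ} (ht : 0 ≤ t) :
    1 / 2 * (∫ s in (0 : ℝ)..t, ‖vectorField Ω K (regKernel α c ε) (u s)‖ ^ 2) ≤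
      ‖Ω‖ ^ 2 / 2 * t + interactionPotential K (singKernel α c) x₀ :=
  (energy_estimate (regKernel_neg α c ε) (continuous_regKernel α hc hε.ne')
    (integral_regKernel_nonneg hc hε.ne') hK.le hu ht).trans
    (add_le_add_right (interactionPotential_mono hK.le
      (integral_regKernel_le hc (by linarith [hα.1]) hα.2 hε.ne') x₀) _)

/-- Pointwise bound for a classical solution in terms of a bound of its dissipation. -/
theorem IsClassicalSolution.norm_le {F : Phase N → Phase N} {x₀ : Phase N} {u : ℝ → Phase N}
    (hF : Continuous F) (hu : IsClassicalSolution F x₀ u) {t T E : ℝ} (ht : t ∈ Icc 0 T)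
    (hE : ∫ r in (0 : ℝ)..T, ‖F (u r)‖ ^ 2 ≤ E) : ‖u t‖ ≤ ‖x₀‖ + (E + T) / 2 := by
  have h1 := hu.norm_sub_le hF le_rfl ht.1 ht.2 one_pos
  rw [hu.1] at h1
  have h2 := norm_le_norm_add_norm_sub x₀ (u t)
  have h3 := ht.2
  rw [norm_sub_rev] at h1
  linarith

/-- Bound of the `H¹` norm of a classical solution in terms of a bound of its dissipation. -/
theorem IsClassicalSolution.exists_norm_le {F : Phase N → Phase N} {x₀ : Phase N}
    {u : ℝ → Phase N} (hF : Continuous F) (hu : IsClassicalSolution F x₀ u) {T E : ℝ} (hT : 0 ≤ T)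
    (hE : ∫ r in (0 : ℝ)..T, ‖F (u r)‖ ^ 2 ≤ E) :
    ∃ p : H1 N T, RepresentsH1 p u ∧
      ‖p‖ ≤ Real.sqrt (T * (‖x₀‖ + (E + T) / 2) ^ 2 + E) := by
  obtain ⟨p, hp, hnorm⟩ := hu.exists_representsH1 hF hT
  refine ⟨p, hp, Real.le_sqrt_of_sq_le ?_⟩
  rw [hnorm]
  refine add_le_add ?_ hE
  have hint : IntervalIntegrable (fun t => ‖u t‖ ^ 2) volume 0 T :=
    (continuousOn_uIcc (hu.continuousOn.norm.pow 2) le_rfl hT).intervalIntegrable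
  calc ∫ t in (0 : ℝ)..T, ‖u t‖ ^ 2
      ≤ ∫ _ in (0 : ℝ)..T, (‖x₀‖ + (E + T) / 2) ^ 2 := by
        refine intervalIntegral.integral_mono_on hT hint intervalIntegrable_const fun t ht => ?_
        have := hu.norm_le hF ht hE
        gcongr
    _ = T * (‖x₀‖ + (E + T) / 2) ^ 2 := by
        rw [intervalIntegral.integral_const, smul_eq_mul, sub_zero]

end SingularKuramoto

theorem mainTheorem7 (N : ℕ) (Ω Θ₀ : SingularKuramoto.Phase N) (K c α : ℝ)
    (hK : 0 < K) (hc : 0 < c) (hα : α ∈ Ioo (1 / 2 : ℝ) 1)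
    (Θε : ℝ → ℝ → SingularKuramoto.Phase N)
    (hΘε : ∀ ε : ℝ, 0 < ε → SingularKuramoto.IsClassicalSolution
      (SingularKuramoto.vectorField Ω K (SingularKuramoto.regKernel α c ε)) Θ₀ (Θε ε)) :
    -- the regularized system is the gradient flow of the regularized potential
    (∀ ε : ℝ, 0 < ε → ∀ x : SingularKuramoto.Phase N,
      HasGradientAt (SingularKuramoto.potential Ω K (SingularKuramoto.regKernel α c ε))
        (-SingularKuramoto.vectorField Ω K (SingularKuramoto.regKernel α c ε) x) x) ∧
    -- energy estimate
    (∀ ε : ℝ, 0 < ε → ∀ t : ℝ, 0 < t →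
      1 / 2 * (∫ s in (0 : ℝ)..t, ‖deriv (Θε ε) s‖ ^ 2) ≤
        ‖Ω‖ ^ 2 / 2 * t +
          SingularKuramoto.interactionPotential K (SingularKuramoto.singKernel α c) Θ₀) ∧
    -- boundedness in `H¹_loc`, uniformly in `ε`
    (∀ T : ℝ, 0 < T → ∃ C : ℝ, ∀ ε : ℝ, 0 < ε → ∃ p : SingularKuramoto.H1 N T,
      SingularKuramoto.RepresentsH1 p (Θε ε) ∧ ‖p‖ ≤ C) ∧
    -- every weak `H¹_loc` limit solves the differential inclusion and is a Filippov solution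
    (∀ (ε : ℕ → ℝ), (∀ n, 0 < ε n) → Tendsto ε atTop (𝓝 0) →
      ∀ Θ Θ' : ℝ → SingularKuramoto.Phase N,
        SingularKuramoto.IsWeakH1LocLimit (fun n => Θε (ε n)) Θ Θ' →
        (∀ᵐ t ∂(volume.restrict (Ioi (0 : ℝ))), Θ' t ∈ SingularKuramoto.filippovMap
          (SingularKuramoto.vectorField Ω K (SingularKuramoto.singKernel α c)) (Θ t)) ∧
        ∃ Φ : ℝ → SingularKuramoto.Phase N,
          Φ =ᵐ[volume.restrict (Ioi (0 : ℝ))] Θ ∧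
          SingularKuramoto.IsFilippovSolution
            (SingularKuramoto.vectorField Ω K (SingularKuramoto.singKernel α c)) Θ₀ Φ) := by
  have hcont : ∀ ε : ℝ, 0 < ε → Continuous (SingularKuramoto.regKernel α c ε) := fun ε hε =>
    SingularKuramoto.continuous_regKernel α hc hε.ne'
  have hF : ∀ ε : ℝ, 0 < ε →
      Continuous (SingularKuramoto.vectorField Ω K (SingularKuramoto.regKernel α c ε)) :=
    fun ε hε => SingularKuramoto.continuous_vectorField (hcont ε hε) Ω K
  have hE : ∀ ε : ℝ, 0 < ε → ∀ T : ℝ, 0 < T →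
      ∫ r in (0 : ℝ)..T, ‖SingularKuramoto.vectorField Ω K (SingularKuramoto.regKernel α c ε)
        (Θε ε r)‖ ^ 2 ≤ 2 * (‖Ω‖ ^ 2 / 2 * T +
          SingularKuramoto.interactionPotential K (SingularKuramoto.singKernel α c) Θ₀) :=
    fun ε hε T hT => by
      have := SingularKuramoto.energy_estimate_regKernel hK hc hα hε (hΘε ε hε) hT.le
      linarith
  refine ⟨fun ε hε x => SingularKuramoto.hasGradientAt_potential
    (SingularKuramoto.regKernel_neg α c ε) (hcont ε hε) Ω K x, fun ε hε t ht => ?_,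
    fun T hT => ⟨_, fun ε hε =>
      (hΘε ε hε).exists_norm_le (hF ε hε) hT.le (hE ε hε T hT)⟩, ?_⟩
  · refine le_of_eq_of_le ?_
      (SingularKuramoto.energy_estimate_regKernel hK hc hα hε (hΘε ε hε) ht.le)
    congr 1
    -- The interval is open at `0`, where only a one-sided derivative is known.
    refine intervalIntegral.integral_congr_ae (Eventually.of_forall fun s hs => ?_)
    rw [uIoc_of_le ht.le] at hs
    rw [((hΘε ε hε).hasDerivAt hs.1).deriv]
  · intro ε hε hlim Θ Θ' hweak
    set Φ : ℝ → SingularKuramoto.Phase N := fun t => Θ₀ + ∫ s in (0 : ℝ)..t, Θ' s with hΦ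
    have hF' := fun n => hF (ε n) (hε n)
    have hu := fun n => hΘε (ε n) (hε n)
    have hΦΘ : Φ =ᵐ[volume.restrict (Ioi (0 : ℝ))] Θ :=
      hweak.ae_eq_primitive hF' hu fun T hT =>
        ⟨_, fun n t ht => (hu n).norm_le (hF' n) ht (hE (ε n) (hε n) T hT)⟩
    have hder := hweak.ae_hasDerivAt_primitive Θ₀
    have hincl : ∀ᵐ t ∂(volume.restrict (Ioi (0 : ℝ))), Θ' t ∈ SingularKuramoto.filippovMap
        (SingularKuramoto.vectorField Ω K (SingularKuramoto.singKernel α c)) (Φ t) := by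
      filter_upwards [hder, ae_restrict_mem measurableSet_Ioi] with t ht ht0
      refine SingularKuramoto.mem_filippovMap_of_inner_eq hc hα.1 hK Ω fun w hw => ?_
      refine SingularKuramoto.inner_deriv_eq_of_tendsto hF' hu
        (fun T hT => ⟨_, fun n => hE (ε n) (hε n) T hT⟩)
        (fun s hs => hweak.tendsto_apply hF' hu hs) ht0 ht ?_
      -- Joint continuity at `(0, Φ t)`, evaluated along `(ε n, z)`, supplies the locally uniform
      -- convergence of the pairing.
      have h := (SingularKuramoto.continuousAt_inner_vectorField α hc Ω K 0
        fun i j => mt (hw i j)).tendsto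
      rw [SingularKuramoto.singKernel_eq_regKernel_zero α hc.le]
      refine h.comp (f := fun p : ℕ × SingularKuramoto.Phase N => (ε p.1, p.2)) ?_
      rw [nhds_prod_eq]
      exact hlim.prodMap tendsto_id
    refine ⟨?_, Φ, hΦΘ, by simp [hΦ], fun T hT =>
      SingularKuramoto.absolutelyContinuousOnInterval_primitive
        (hweak.intervalIntegrable hT.le) Θ₀, ?_⟩
    · filter_upwards [hincl, hΦΘ] with t ht h
      rwa [← h]
    · filter_upwards [hincl, hder] with t ht hd
      exact ⟨_, ht, hd⟩
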